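/- Let $\Sigma$ be a nonempty finite alphabet with a fixed arbitrary padding symbol $\Box\in\Sigma$. For a stream $w\in\Sigma^*$ and $n\in\mathbb N$, let $\mathrm{last}_n(w)\in\Sigma^n$ be the suffix of length $n$ of $w$, padded on the left with symbols $\Box$ if $|w|<n$. The Hamming distance of two words of equal length is the number of positions at which they differ, it is $\infty$ for words of different lengths, and $\mathrm{dist}(u,L)=\inf_{v\in L}\mathrm{dist}(u,v)\in\mathbb N\cup\{\infty\}$. A deterministic (respectively randomized) streaming algorithm is a deterministic (respectively probabilistic) automaton over $\Sigma$ with a nonempty, possibly infinite, state set $Q$; it uses $\log_2|Q|$ bits of space, and it accepts $w$ if its state after reading $w$ is final and rejects $w$ otherwise. Let $\gamma:\mathbb N\to\mathbb R_{\ge 0}$. A deterministic sliding-window tester with Hamming gap $\gamma(n)$ for $L\subseteq\Sigma^*$ and window size $n$ is a deterministic streaming algorithm that, for all $w\in\Sigma^*$, accepts $w$ if $\mathrm{last}_n(w)\in L$ and rejects $w$ if $\mathrm{dist}(\mathrm{last}_n(w),L)>\gamma(n)$. A randomized sliding-window tester with two-sided error is a randomized streaming algorithm that, for all $w\in\Sigma^*$,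 accepts $w$ with probability at least $2/3$ in the first case and rejects $w$ with probability at least $2/3$ in the second case. **Theorem.** Let $L\subseteq\Sigma^*$ be a regular language. (i) There are constants $c,C\ge 0$ such that for every window size $n\in\mathbb N$ there is a deterministic sliding-window tester $\mathcal P_n$ for $L$ and window size $n$ with Hamming gap $c$ that uses finite space, and at most $C\log_2 n$ bits if $n\ge 2$. (ii) There is a constant $C\ge 0$ such that for every real $\epsilon>0$ and every window size $n\in\mathbb N$ there is a randomized sliding-window tester for $L$ and window size $n$ with two-sided error and Hamming gap $\epsilon n$ that uses at most $C/\epsilon$ bits of space. -/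

import Mathlib

open scoped NNReal ENNReal

namespace SlidingWindow

noncomputable section

/-- The active window of length `n` of the stream `w`: the last `n` symbols of `w`, padded on the
left with the symbol `pad` if `w` is shorter than `n`. -/
def window {α : Type*} (pad : α) (n : ℕ) (w : List α) : List α :=
  (w.rtake n).leftpad n pad

open Classical in
/-- Hamming distance of two words; it is infinite if the lengths differ. -/
def wordDist {α : Type*} (u v : List α) : ℕ∞ :=
  if h : u.length = v.length then
    (hammingDist (fun i : Fin u.length => u.get i) (fun i => v.get (i.cast h)) : ℕ)
  else ⊤

/-- Hamming distance of a word to a language; it is infinite if the language contains no word of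
that length. -/
def langDist {α : Type*} (u : List α) (L : Language α) : ℕ∞ :=
  ⨅ v ∈ L, wordDist u v

/-- The number of bits `log₂ |M|` needed to store an element of the set `M` of memory states. -/
def bits (M : Type*) : ℝ≥0∞ :=
  open Classical in if Finite M then ENNReal.ofReal (Real.logb 2 (Nat.card M)) else ⊤

/-- A deterministic streaming algorithm is a deterministic automaton whose set `M` of (memory)
states may be infinite. -/
abbrev StreamingAlgorithm (α M : Type*) := DFA α M

/-- The space of a deterministic streaming algorithm, in bits. -/
def StreamingAlgorithm.space {α M : Type*} (_P : StreamingAlgorithm α M) : ℝ≥0∞ := bits M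

/-- A randomized streaming algorithm is a probabilistic automaton whose set `M` of states may be
infinite. -/
structure RandomizedStreamingAlgorithm (α M : Type*) where
  /-- initial state distribution -/
  init : PMF M
  /-- transition probabilities -/
  step : M → α → PMF M
  /-- final states -/
  final : Set M

namespace RandomizedStreamingAlgorithm

variable {α M : Type*} (P : RandomizedStreamingAlgorithm α M)

/-- The distribution of the state reached after reading the word `w` from left to right. -/
def run (w : List α) : PMF M :=
  w.foldl (fun X a => X.bind fun p => P.step p a) P.init

/-- The probability that `P` accepts `w`. -/
def acceptProb (w : List α) : ℝ≥0∞ := (P.run w).toOuterMeasure P.final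

/-- The probability that `P` rejects `w`. -/
def rejectProb (w : List α) : ℝ≥0∞ := (P.run w).toOuterMeasure P.finalᶜ

/-- The space of a randomized streaming algorithm, in bits. -/
def space (_P : RandomizedStreamingAlgorithm α M) : ℝ≥0∞ := bits M

end RandomizedStreamingAlgorithm

/-- `P` is a deterministic sliding window tester with Hamming gap `γ` for the language `L` and
window size `n`. -/
structure IsDeterministicTester {α M : Type*} (pad : α) (L : Language α) (γ : ℕ → ℝ≥0) (n : ℕ)
    (P : StreamingAlgorithm α M) : Prop where
  accepts_of_mem : ∀ w : List α, window pad n w ∈ L → w ∈ P.accepts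
  rejects_of_far : ∀ w : List α,
    (γ n : ℝ≥0∞) < (langDist (window pad n w) L : ℝ≥0∞) → w ∉ P.accepts

/-- `P` is a randomized sliding window tester with two-sided error and Hamming gap `γ` for the
language `L` and window size `n`. -/
structure IsTwoSidedTester {α M : Type*} (pad : α) (L : Language α) (γ : ℕ → ℝ≥0) (n : ℕ)
    (P : RandomizedStreamingAlgorithm α M) : Prop where
  accepts_of_mem : ∀ w : List α, window pad n w ∈ L → 2 / 3 ≤ P.acceptProb w
  rejects_of_far : ∀ w : List α,
    (γ n : ℝ≥0∞) < (langDist (window pad n w) L : ℝ≥0∞) → 2 / 3 ≤ P.rejectProb w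

end

end SlidingWindow

/-! Run a finite automaton `A` for the reversed language from the newest window symbol to the
oldest. A new stream symbol is prepended to the reversed word, so the table of first-visit times
over all pairs `(q, p)` can be updated locally: row `q` becomes the shifted row of `A.step q a`.

First-visit times almost decide membership. The relations `Reaches A k` are periodic for `k ≥ N`,
with period `G`. If the window is in `L`, each state first visited at `t ≤ n - N` has an accepting
run of length at least `N` and congruent to `n - t` mod `G` (`reachesAccept_of_firstVisit`).
Conversely, if this holds for all `t ≤ n - d`, where `N ≤ d ≤ n`, the state at time `n - d` lies on
a loop back to its first visit. Going round it `G - 1` times corrects the residue, and periodicity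
gives an accepting run of length exactly `d` (`exists_accepted_extension`), so the window is within
distance `d` of `L`.

Hence it suffices to know `t` mod `G` and whether `t` is small. For (i), a counter truncated at `n -
N + 1` does this with gap `N`. For (ii), incrementing with probability about `1 / (ε² n)` leaves
`O(1 / ε²)` counter values, and Chebyshev's inequality separates early from late visits
(`coinCount_threshold`). This costs `O(log (1 / ε))` bits; the bound `C / ε` also covers short
windows, which are stored outright. -/

namespace SlidingWindow

/-! ### Periodicity of run lengths and first visits -/

section Automata

variable {α Q : Type*}

/-- The automaton `A` has a run of length exactly `k` from `p` to `q`. -/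
def Reaches (A : DFA α Q) (k : ℕ) (p q : Q) : Prop :=
  ∃ y : List α, y.length = k ∧ A.evalFrom p y = q

theorem Reaches.refl (A : DFA α Q) (p : Q) : Reaches A 0 p p := ⟨[], rfl, rfl⟩

theorem Reaches.trans {A : DFA α Q} {k l : ℕ} {p q r : Q} (h₁ : Reaches A k p q)
    (h₂ : Reaches A l q r) : Reaches A (k + l) p r := by
  obtain ⟨y, rfl, rfl⟩ := h₁
  obtain ⟨z, rfl, rfl⟩ := h₂
  exact ⟨y ++ z, by simp, by simp [DFA.evalFrom_of_append]⟩

theorem Reaches.iterate {A : DFA α Q} {k : ℕ} {p : Q} (h : Reaches A k p p) (j : ℕ) :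
    Reaches A (j * k) p p := by
  induction j with
  | zero => simpa using Reaches.refl A p
  | succ j ih => rw [Nat.succ_mul]; exact ih.trans h

theorem reaches_succ_iff {A : DFA α Q} {k : ℕ} {p r : Q} :
    Reaches A (k + 1) p r ↔ ∃ q, Reaches A k p q ∧ Reaches A 1 q r := by
  constructor
  · rintro ⟨y, hy, rfl⟩
    refine ⟨A.evalFrom p (y.take k), ⟨y.take k, by simp [hy], rfl⟩, y.drop k, by simp [hy], ?_⟩
    rw [← DFA.evalFrom_of_append, List.take_append_drop]
  · rintro ⟨q, h₁, h₂⟩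
    exact h₁.trans h₂

/-- The relation for length `k + 1` is determined by the one for `k`, so a single coincidence
propagates. -/
theorem reaches_congr_add {A : DFA α Q} {i j : ℕ} (h : Reaches A i = Reaches A j) (k : ℕ) :
    Reaches A (i + k) = Reaches A (j + k) := by
  induction k with
  | zero => exact h
  | succ k ih =>
    funext p q
    rw [← Nat.add_assoc, ← Nat.add_assoc, reaches_succ_iff (k := i + k),
      reaches_succ_iff (k := j + k), ih]

/-- In a finite automaton, the relations `Reaches A k` are eventually periodic in `k`. -/
theorem exists_reaches_periodic [Finite Q] (A : DFA α Q) :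
    ∃ N G : ℕ, 0 < G ∧ ∀ k, N ≤ k → Reaches A (k + G) = Reaches A k := by
  obtain ⟨i, j, hij, h⟩ := Finite.exists_ne_map_eq_of_infinite (fun k => Reaches A k)
  wlog hlt : i < j generalizing i j
  · exact this j i hij.symm h.symm (by omega)
  refine ⟨i, j - i, by omega, fun k hk => ?_⟩
  have := reaches_congr_add h (k - i)
  rw [show k + (j - i) = j + (k - i) by omega, ← this]
  congr 1
  omega

theorem reaches_congr_modEq {A : DFA α Q} {N G : ℕ}
    (hper : ∀ k, N ≤ k → Reaches A (k + G) = Reaches A k) {k l : ℕ} (hk : N ≤ k) (hl : N ≤ l)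
    (h : k ≡ l [MOD G]) : Reaches A k = Reaches A l := by
  wlog hle : k ≤ l generalizing k l
  · exact (this hl hk h.symm (by omega)).symm
  have hmul : ∀ j, Reaches A (k + G * j) = Reaches A k := by
    intro j
    induction j with
    | zero => rfl
    | succ j ih => rw [Nat.mul_succ, ← Nat.add_assoc, hper _ (by omega), ih]
  obtain ⟨j, hj⟩ := (Nat.modEq_iff_dvd' hle).1 h
  rw [show l = k + G * j by omega, hmul]

open Classical in
/-- The first time at which the run of `A` on `v` from `q` visits `p`. -/
noncomputable def firstVisit (A : DFA α Q) : List α → Q → Q → Option ℕ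
  | [], q, p => if q = p then some 0 else none
  | a :: v, q, p => if q = p then some 0 else (firstVisit A v (A.step q a) p).map (· + 1)

theorem firstVisit_spec {A : DFA α Q} {v : List α} {q p : Q} {t : ℕ}
    (h : firstVisit A v q p = some t) : t ≤ v.length ∧ A.evalFrom q (v.take t) = p := by
  induction v generalizing q t with
  | nil =>
    simp only [firstVisit] at h
    split_ifs at h with hq
    cases h
    simpa using hq
  | cons a v ih =>
    simp only [firstVisit] at h
    split_ifs at h with hq
    · cases h
      simpa using hq
    · obtain ⟨s, hs, rfl⟩ := Option.map_eq_some_iff.1 h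
      obtain ⟨h₁, h₂⟩ := ih hs
      exact ⟨by simpa using h₁, by simpa using h₂⟩

theorem exists_firstVisit_le (A : DFA α Q) (v : List α) (q : Q) (k : ℕ) (hk : k ≤ v.length) :
    ∃ t ≤ k, firstVisit A v q (A.evalFrom q (v.take k)) = some t := by
  induction v generalizing q k with
  | nil => exact ⟨0, by simp, by simp [firstVisit]⟩
  | cons a v ih =>
    cases k with
    | zero => exact ⟨0, le_rfl, by simp [firstVisit]⟩
    | succ k =>
      obtain ⟨t, ht, h⟩ := ih (A.step q a) k (by simpa using hk)
      simp only [List.take_succ_cons, DFA.evalFrom_cons, firstVisit]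
      by_cases hq : q = A.evalFrom (A.step q a) (v.take k)
      · exact ⟨0, by omega, if_pos hq⟩
      · exact ⟨t + 1, by omega, (if_neg hq).trans (by rw [h]; rfl)⟩

/-- The segment of the run after the first visit is the witness. With `k = n` it yields accepting
runs; when the state at time `k` is again `p` it yields loops. -/
theorem reaches_of_firstVisit {A : DFA α Q} {v : List α} {q p : Q} {t k : ℕ}
    (h : firstVisit A v q p = some t) (htk : t ≤ k) (hk : k ≤ v.length) :
    Reaches A (k - t) p (A.evalFrom q (v.take k)) := by
  obtain ⟨-, rfl⟩ := firstVisit_spec h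
  refine ⟨(v.take k).drop t, by simp [hk], ?_⟩
  rw [← DFA.evalFrom_of_append]
  congr 1
  have : v.take t = (v.take k).take t := by rw [List.take_take, min_eq_left htk]
  rw [this, List.take_append_drop]

/-- Some accepting state is reached from `p` by a run whose length is at least `N` and belongs to
the residue class `r`. -/
def ReachesAccept (A : DFA α Q) (N : ℕ) {G : ℕ} (p : Q) (r : ZMod G) : Prop :=
  ∃ k, N ≤ k ∧ (k : ZMod G) = r ∧ ∃ f ∈ A.accept, Reaches A k p f

theorem reachesAccept_of_firstVisit {A : DFA α Q} {N G n t : ℕ} {v : List α} {p : Q}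
    (hn : n ≤ v.length) (hacc : A.evalFrom A.start (v.take n) ∈ A.accept)
    (h : firstVisit A v A.start p = some t) (ht : t + N ≤ n) :
    ReachesAccept A N p ((n : ZMod G) - (t : ZMod G)) :=
  ⟨n - t, by omega, by rw [Nat.cast_sub (by omega)], _, hacc,
    reaches_of_firstVisit h (by omega) hn⟩

/-- If every state visited by the first `n - d` steps can still reach an accepting state with the
right residue, then the prefix of length `n - d` extends to an accepted word of length `n`. -/
theorem exists_accepted_extension {A : DFA α Q} {N G n d : ℕ}
    (hper : ∀ k, N ≤ k → Reaches A (k + G) = Reaches A k) (hG : 0 < G) {v : List α}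
    (hn : n ≤ v.length) (hdn : d ≤ n) (hNd : N ≤ d)
    (H : ∀ p t, firstVisit A v A.start p = some t → t + d ≤ n →
      ReachesAccept A N p ((n : ZMod G) - (t : ZMod G))) :
    ∃ z : List α, z.length = d ∧ A.evalFrom A.start (v.take (n - d) ++ z) ∈ A.accept := by
  set s := A.evalFrom A.start (v.take (n - d)) with hs
  obtain ⟨t, ht, hsv⟩ := exists_firstVisit_le A v A.start (n - d) (by omega)
  have hps : Reaches A (n - d - t) s s := reaches_of_firstVisit hsv ht (by omega)
  obtain ⟨l, hNl, hl, f, hf, hpf⟩ := H s t hsv (by omega)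
  set m := n - d - t with hm
  -- Modulo `G`, the `G - 1` loops contribute `-m`, which turns the residue `n - t` of `l` into `d`.
  have hloop : Reaches A ((G - 1) * m + l) s f := (hps.iterate (G - 1)).trans hpf
  have hmod : (G - 1) * m + l ≡ d [MOD G] := by
    rw [← ZMod.natCast_eq_natCast_iff]
    obtain ⟨g, rfl⟩ : ∃ g, G = g + 1 := ⟨G - 1, by omega⟩
    have hg : ((g : ℕ) : ZMod (g + 1)) = -1 := by
      have : ((g + 1 : ℕ) : ZMod (g + 1)) = 0 := ZMod.natCast_self _
      push_cast at this
      exact eq_neg_of_add_eq_zero_left this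
    have hmc : (m : ZMod (g + 1)) = n - d - t := by
      rw [hm, Nat.cast_sub (by omega), Nat.cast_sub (by omega)]
    push_cast
    simp only [hg, hl, hmc]
    ring
  rw [reaches_congr_modEq hper (by omega) hNd hmod] at hloop
  obtain ⟨z, hz, hzf⟩ := hloop
  exact ⟨z, hz, by rw [DFA.evalFrom_of_append, ← hs, hzf]; exact hf⟩

end Automata

/-! ### Windows, padding and Hamming distance -/

section Windows

variable {α : Type*}

/-- The stream `w`, preceded by `n` padding symbols, in reverse order. -/
def paddedReverse (pad : α) (n : ℕ) (w : List α) : List α := w.reverse ++ List.replicate n pad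

theorem length_paddedReverse (pad : α) (n : ℕ) (w : List α) :
    n ≤ (paddedReverse pad n w).length := by simp [paddedReverse]

theorem reverse_window (pad : α) (n : ℕ) (w : List α) :
    (window pad n w).reverse = (paddedReverse pad n w).take n := by
  simp only [window, List.rtake_eq_reverse_take_reverse, List.leftpad, paddedReverse,
    List.reverse_append, List.reverse_reverse, List.reverse_replicate, List.take_append,
    List.take_replicate, List.length_reverse, List.length_take]
  congr 2
  omega

theorem length_window (pad : α) (n : ℕ) (w : List α) : (window pad n w).length = n := by
  rw [← List.length_reverse, reverse_window, List.length_take]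
  exact min_eq_left (length_paddedReverse pad n w)

theorem window_window_append (pad : α) (n : ℕ) (w : List α) (a : α) :
    window pad n (window pad n w ++ [a]) = window pad n (w ++ [a]) := by
  apply List.reverse_injective
  cases n with
  | zero => simp [reverse_window]
  | succ n =>
    rw [reverse_window, reverse_window]
    simp only [paddedReverse, List.reverse_append, List.reverse_singleton, List.nil_append,
      List.cons_append, List.take_succ_cons, reverse_window]
    rw [List.take_append_of_le_length (by simp), List.take_take, min_eq_left (by omega)]

theorem wordDist_append_le (x z y : List α) (h : x.length = z.length) :
    wordDist (x ++ y) (z ++ y) ≤ x.length := by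
  classical
  have hl : (x ++ y).length = (z ++ y).length := by simp [h]
  rw [wordDist, dif_pos hl, Nat.cast_le]
  refine le_trans (b := (Finset.univ.filter fun i : Fin (x ++ y).length =>
    (i : ℕ) < x.length).card) ?_ ?_
  · unfold hammingDist
    refine Finset.card_le_card fun i hi => ?_
    simp only [Finset.mem_filter, Finset.mem_univ, true_and] at hi ⊢
    by_contra hlt
    apply hi
    simp [List.getElem_append_right (not_lt.1 hlt), List.getElem_append_right (h ▸ not_lt.1 hlt), h]
  · rw [Fin.card_filter_val_lt]
    exact min_le_right _ _

theorem langDist_le {u v : List α} {L : Language α} (hv : v ∈ L) {d : ℕ∞}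
    (h : wordDist u v ≤ d) : langDist u L ≤ d :=
  (iInf₂_le v hv).trans h

theorem langDist_le_length {u v : List α} {L : Language α} (hv : v ∈ L)
    (h : u.length = v.length) : langDist u L ≤ u.length :=
  langDist_le hv (by simpa using wordDist_append_le u v [] h)

/-- Acceptance of a window in terms of an automaton for the reversed language. -/
theorem window_mem_iff {Q : Type*} {A : DFA α Q} {L : Language α} (hA : A.accepts = L.reverse)
    (pad : α) (n : ℕ) (w : List α) : window pad n w ∈ L ↔
      A.evalFrom A.start ((paddedReverse pad n w).take n) ∈ A.accept := by
  rw [← reverse_window, ← Language.reverse_mem_reverse, ← hA]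
  rfl

/-- The accepted extension changes only the last `d` letters of the reversed window, that is, its
`d` oldest symbols. -/
theorem langDist_window_le {Q : Type*} {A : DFA α Q} {L : Language α}
    (hA : A.accepts = L.reverse) {N G n d : ℕ}
    (hper : ∀ k, N ≤ k → Reaches A (k + G) = Reaches A k) (hG : 0 < G) (pad : α) (w : List α)
    (hdn : d ≤ n) (hNd : N ≤ d)
    (H : ∀ p t, firstVisit A (paddedReverse pad n w) A.start p = some t → t + d ≤ n →
      ReachesAccept A N p ((n : ZMod G) - (t : ZMod G))) :
    langDist (window pad n w) L ≤ d := by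
  have hn := length_paddedReverse pad n w
  obtain ⟨z, hz, hacc⟩ := exists_accepted_extension hper hG hn hdn hNd H
  set v := paddedReverse pad n w
  have hw : window pad n w = ((v.take n).drop (n - d)).reverse ++ (v.take (n - d)).reverse := by
    apply List.reverse_injective
    rw [reverse_window, List.reverse_append, List.reverse_reverse, List.reverse_reverse]
    have : v.take (n - d) = (v.take n).take (n - d) := by
      rw [List.take_take, min_eq_left (by omega)]
    rw [this, List.take_append_drop]
  have hmem : z.reverse ++ (v.take (n - d)).reverse ∈ L := by
    rw [← Language.reverse_mem_reverse, ← hA, List.reverse_append, List.reverse_reverse,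
      List.reverse_reverse]
    exact hacc
  have hlen : ((v.take n).drop (n - d)).reverse.length = d := by
    simp only [List.length_reverse, List.length_drop, List.length_take]
    omega
  refine langDist_le hmem ?_
  rw [hw]
  refine (wordDist_append_le _ _ _ (by rw [hlen]; simp [hz])).trans ?_
  rw [hlen]

end Windows

end SlidingWindow

namespace SlidingWindow

/-! ### Expectations and Chebyshev's inequality for the binomial distribution -/

section Probability

/-- The expectation of a nonnegative function. -/
noncomputable def expect {α : Type*} (p : PMF α) (g : α → ℝ≥0∞) : ℝ≥0∞ := ∑' a, p a * g a

theorem expect_pure {α : Type*} (a : α) (g : α → ℝ≥0∞) : expect (PMF.pure a) g = g a := by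
  rw [expect, tsum_eq_single a]
  · simp
  · intro b hb
    simp [PMF.pure_apply_of_ne _ _ hb]

theorem expect_bind {α β : Type*} (p : PMF α) (f : α → PMF β) (g : β → ℝ≥0∞) :
    expect (p.bind f) g = expect p fun a => expect (f a) g := by
  simp only [expect, PMF.bind_apply, ← ENNReal.tsum_mul_right, ← ENNReal.tsum_mul_left, mul_assoc]
  exact ENNReal.tsum_comm

theorem expect_map {α β : Type*} (p : PMF α) (f : α → β) (g : β → ℝ≥0∞) :
    expect (p.map f) g = expect p (g ∘ f) := by
  rw [← PMF.bind_pure_comp, expect_bind]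
  simp only [Function.comp_apply, expect_pure]
  rfl

theorem expect_add_const {α : Type*} (p : PMF α) (g : α → ℝ≥0∞) (c : ℝ≥0∞) :
    (expect p fun a => g a + c) = expect p g + c := by
  simp only [expect, mul_add, ENNReal.tsum_add, ENNReal.tsum_mul_right, p.tsum_coe, one_mul]

/-- Markov's inequality. -/
theorem mul_toOuterMeasure_le_expect {α : Type*} (p : PMF α) (g : α → ℝ≥0∞) (s : Set α)
    (c : ℝ≥0∞) (h : ∀ a ∈ s, c ≤ g a) : c * p.toOuterMeasure s ≤ expect p g := by
  rw [PMF.toOuterMeasure_apply, ← ENNReal.tsum_mul_left, expect]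
  refine ENNReal.tsum_le_tsum fun a => ?_
  by_cases ha : a ∈ s
  · rw [Set.indicator_of_mem ha, mul_comm]
    gcongr
    exact h a ha
  · simp [Set.indicator_of_notMem ha]

theorem toOuterMeasure_add_compl {α : Type*} (p : PMF α) (s : Set α) :
    p.toOuterMeasure s + p.toOuterMeasure sᶜ = 1 := by
  rw [PMF.toOuterMeasure_apply, PMF.toOuterMeasure_apply, ← ENNReal.tsum_add, ← p.tsum_coe]
  congr 1
  funext a
  exact Set.indicator_self_add_compl_apply s p a

theorem two_thirds_le_of_compl_le {α : Type*} (p : PMF α) (s : Set α)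
    (h : p.toOuterMeasure sᶜ ≤ 1 / 3) : 2 / 3 ≤ p.toOuterMeasure s := by
  have h23 : (2 / 3 : ℝ≥0∞) + 1 / 3 = 1 := by
    rw [ENNReal.div_add_div_same, show (2 : ℝ≥0∞) + 1 = 3 by norm_num]
    exact ENNReal.div_self (by norm_num) (by norm_num)
  have h3 : (1 / 3 : ℝ≥0∞) ≠ ⊤ := ENNReal.div_ne_top (by norm_num) (by norm_num)
  rw [← ENNReal.add_le_add_iff_right h3]
  exact (h23.trans (toOuterMeasure_add_compl p s).symm).le.trans (add_le_add le_rfl h)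

/-- A coin showing `true` with probability `β`. -/
noncomputable def coin (β : ℝ≥0) (hβ : β ≤ 1) : PMF Bool :=
  PMF.ofFintype (fun b => cond b (β : ℝ≥0∞) (1 - β)) (by
    simp [add_tsub_cancel_of_le (ENNReal.coe_le_one_iff.2 hβ)])

theorem expect_coin (β : ℝ≥0) (hβ : β ≤ 1) (g : Bool → ℝ≥0∞) :
    expect (coin β hβ) g = β * g true + (1 - β) * g false := by
  simp [expect, coin]

/-- The binomial distribution: the number of successes among `t` coin tosses. -/
noncomputable def coinCount (β : ℝ≥0) (hβ : β ≤ 1) : ℕ → PMF ℕ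
  | 0 => PMF.pure 0
  | t + 1 => (coinCount β hβ t).bind fun c => (coin β hβ).map fun b => c + b.toNat

/-- Each toss adds a centred increment of variance `β (1 - β)`; the cross term vanishes, so the mean
need not be computed separately. -/
theorem expect_coinCount_sq (β : ℝ≥0) (hβ : β ≤ 1) (t : ℕ) :
    expect (coinCount β hβ t) (fun c => ENNReal.ofReal ((c - β * t) ^ 2)) =
      ENNReal.ofReal (t * (β * (1 - β))) := by
  have hβ' : (0 : ℝ) ≤ 1 - β := sub_nonneg.2 (by exact_mod_cast hβ)
  induction t with
  | zero => simp [coinCount, expect_pure]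
  | succ t ih =>
    have key : ∀ c : ℕ, expect ((coin β hβ).map fun b => c + b.toNat)
        (fun c => ENNReal.ofReal ((c - β * (t + 1 : ℕ)) ^ 2)) =
        ENNReal.ofReal ((c - β * t) ^ 2) + ENNReal.ofReal (β * (1 - β)) := by
      intro c
      have h1 : (1 - β : ℝ≥0∞) = ENNReal.ofReal (1 - β) := by
        rw [ENNReal.ofReal_sub _ β.coe_nonneg]; simp
      have h2 : (β : ℝ≥0∞) = ENNReal.ofReal β := by simp
      rw [expect_map, expect_coin, h1, h2]
      simp only [Function.comp_apply, Bool.toNat_true, Bool.toNat_false]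
      rw [← ENNReal.ofReal_mul β.coe_nonneg, ← ENNReal.ofReal_mul hβ', ← ENNReal.ofReal_add (by positivity)
        (by positivity), ← ENNReal.ofReal_add (by positivity) (mul_nonneg β.coe_nonneg hβ')]
      congr 1
      push_cast
      ring
    rw [coinCount, expect_bind]
    simp only [key]
    rw [expect_add_const, ih, ← ENNReal.ofReal_add (mul_nonneg (by positivity)
      (mul_nonneg β.coe_nonneg hβ')) (mul_nonneg β.coe_nonneg hβ')]
    congr 1
    push_cast
    ring

/-- Chebyshev's inequality for the binomial distribution. -/
theorem coinCount_le_of_deviation (β : ℝ≥0) (hβ : β ≤ 1) (t : ℕ) (s : Set ℕ) (y δ : ℝ)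
    (hs : ∀ c ∈ s, y ≤ |(c : ℝ) - β * t|) (hy : 0 < y) (hδ : β * t ≤ δ * y ^ 2) :
    (coinCount β hβ t).toOuterMeasure s ≤ ENNReal.ofReal δ := by
  have h := mul_toOuterMeasure_le_expect (coinCount β hβ t)
    (fun c => ENNReal.ofReal ((c - β * t) ^ 2)) s (ENNReal.ofReal (y ^ 2)) fun c hc => by
      apply ENNReal.ofReal_le_ofReal
      rw [← sq_abs ((c : ℝ) - β * t)]
      exact pow_le_pow_left₀ hy.le (hs c hc) 2
  rw [expect_coinCount_sq] at h
  have hy2 : (0 : ℝ) < y ^ 2 := by positivity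
  have h0 : ENNReal.ofReal (y ^ 2) ≠ 0 := by simpa using hy.ne'
  rw [← ENNReal.mul_le_mul_iff_right h0 ENNReal.ofReal_ne_top, ← ENNReal.ofReal_mul hy2.le]
  refine h.trans (ENNReal.ofReal_le_ofReal ?_)
  have : (t : ℝ) * (β * (1 - β)) ≤ β * t := by
    have : (0 : ℝ) ≤ t * β * β := by positivity
    linarith
  linarith

end Probability

/-! ### Counter machines, deterministic and randomized -/

noncomputable section Counters

variable {α Q : Type*}

/-- The states of the counter machine: for all `q` and `p`, the residue modulo `G` and a counter
bounded by `K` for the time at which the run from `q` on the reversed stream first visits `p`. -/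
abbrev CounterState (Q : Type*) (G K : ℕ) := Q → Q → Option (ZMod G × Fin (K + 1))

/-- The number `c`, truncated at `K`. -/
def truncate (K c : ℕ) : Fin (K + 1) := ⟨min c K, by omega⟩

/-- Advance the time by one step and the counter by one if `b` is `true`. -/
def tick {G K : ℕ} (b : Bool) (x : ZMod G × Fin (K + 1)) : ZMod G × Fin (K + 1) :=
  (x.1 + 1, truncate K (x.2 + b.toNat))

theorem tick_truncate {G K : ℕ} (b : Bool) (t c : ℕ) :
    tick b ((t : ZMod G), truncate K c) = (((t + 1 : ℕ) : ZMod G), truncate K (c + b.toNat)) := by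
  simp only [tick, truncate, Nat.cast_add, Nat.cast_one, Prod.mk.injEq, Fin.mk.injEq, true_and]
  omega

open Classical in
/-- The state of the counter machine on the empty stream. -/
def counterInit (Q : Type*) (G K : ℕ) : CounterState Q G K :=
  fun q p => if q = p then some (0, truncate K 0) else none

open Classical in
/-- The transition of the counter machine on the symbol `a`, with the coin showing `b`. -/
def counterStep (A : DFA α Q) {G K : ℕ} (m : CounterState Q G K) (a : α) (b : Bool) :
    CounterState Q G K :=
  fun q p => if q = p then some (0, truncate K 0) else (m (A.step q a) p).map (tick b)

/-- The final states of the counter machine for window size `n`. -/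
def counterFinal (A : DFA α Q) (N G K n : ℕ) : Set (CounterState Q G K) :=
  -- A saturated counter marks a visit too late to matter and imposes no condition.
  {m | ∀ p x, m A.start p = some x → (x.2 : ℕ) < K → ReachesAccept A N p ((n : ZMod G) - x.1)}

/-- The deterministic counter machine, whose counters are always increased. -/
def counterDFA (A : DFA α Q) (N G K : ℕ) (pad : α) (n : ℕ) :
    StreamingAlgorithm α (CounterState Q G K) where
  step m a := counterStep A m a true
  -- Reading `n` padding symbols in advance makes the tracked word `paddedReverse pad n w`.
  start := (List.replicate n pad).foldl (fun m a => counterStep A m a true) (counterInit Q G K)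
  accept := counterFinal A N G K n

/-- The transition mirrors the recursion of `firstVisit`. The induction keeps `q` general because
row `q` is computed from row `A.step q a`. -/
theorem foldl_counterStep (A : DFA α Q) (G K : ℕ) (u : List α) (q p : Q) :
    u.foldl (fun m a => counterStep A m a true) (counterInit Q G K) q p =
      (firstVisit A u.reverse q p).map fun t : ℕ => ((t : ZMod G), truncate K t) := by
  induction u using List.reverseRecOn generalizing q p with
  | nil =>
    simp only [List.foldl_nil, counterInit, List.reverse_nil, firstVisit]
    split_ifs <;> simp
  | append_singleton u a ih =>
    simp only [List.foldl_append, List.foldl_cons, List.foldl_nil, List.reverse_append,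
      List.reverse_singleton, List.singleton_append, firstVisit]
    rw [counterStep]
    split_ifs
    · simp
    · rw [ih, Option.map_map, Option.map_map]
      congr 1
      funext t
      exact tick_truncate true t t

theorem counterDFA_eval (A : DFA α Q) (N G K : ℕ) (pad : α) (n : ℕ) (w : List α) (q p : Q) :
    (counterDFA A N G K pad n).eval w q p =
      (firstVisit A (paddedReverse pad n w) q p).map fun t : ℕ => ((t : ZMod G), truncate K t) := by
  rw [paddedReverse, ← List.reverse_replicate, ← List.reverse_append, ← foldl_counterStep,
    List.foldl_append]
  rfl

theorem counterDFA_isDeterministicTester {A : DFA α Q} {L : Language α}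
    (hA : A.accepts = L.reverse) {N G n : ℕ}
    (hper : ∀ k, N ≤ k → Reaches A (k + G) = Reaches A k) (hG : 0 < G) (pad : α) (hn : N ≤ n)
    (γ : ℕ → ℝ≥0) (hγ : N ≤ γ n) :
    IsDeterministicTester pad L γ n (counterDFA A N G (n - N + 1) pad n) where
  accepts_of_mem w hw := by
    intro p x hx hlt
    change (counterDFA A N G (n - N + 1) pad n).eval w A.start p = some x at hx
    rw [counterDFA_eval] at hx
    obtain ⟨t, ht, rfl⟩ := Option.map_eq_some_iff.1 hx
    simp only [truncate] at hlt
    exact reachesAccept_of_firstVisit (length_paddedReverse pad n w)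
      ((window_mem_iff hA pad n w).1 hw) ht (by omega)
  rejects_of_far w hw hacc := by
    refine hw.not_ge ?_
    have h : langDist (window pad n w) L ≤ N :=
      langDist_window_le hA hper hG pad w hn le_rfl fun p t ht htn =>
        hacc p ((t : ZMod G), truncate (n - N + 1) t) (by
          change (counterDFA A N G (n - N + 1) pad n).eval w A.start p = _
          rw [counterDFA_eval, ht]; rfl) (by simp only [truncate]; omega)
    calc ((langDist (window pad n w) L : ℕ∞) : ℝ≥0∞) ≤ ((N : ℕ∞) : ℝ≥0∞) := by
          exact_mod_cast h
      _ ≤ (γ n : ℝ≥0∞) := by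
          rw [ENat.toENNReal_coe]
          exact_mod_cast hγ

/-- The randomized counter machine, whose counters are increased with probability `β`. -/
def counterRandomized (A : DFA α Q) (N G K : ℕ) (pad : α) (n : ℕ) (β : ℝ≥0) (hβ : β ≤ 1) :
    RandomizedStreamingAlgorithm α (CounterState Q G K) where
  init := (List.replicate n pad).foldl
    (fun X a => X.bind fun m => (coin β hβ).map (counterStep A m a)) (PMF.pure (counterInit Q G K))
  step m a := (coin β hβ).map (counterStep A m a)
  final := counterFinal A N G K n

/-- The distribution of the counter for a first visit at time `t`. -/
def counterLaw (G K : ℕ) (β : ℝ≥0) (hβ : β ≤ 1) : Option ℕ → PMF (Option (ZMod G × Fin (K + 1)))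
  | none => PMF.pure none
  | some t => (coinCount β hβ t).map fun c => some ((t : ZMod G), truncate K c)

theorem counterLaw_map_succ (G K : ℕ) (β : ℝ≥0) (hβ : β ≤ 1) (o : Option ℕ) :
    ((counterLaw G K β hβ o).bind fun x => (coin β hβ).map fun b => x.map (tick b)) =
      counterLaw G K β hβ (o.map (· + 1)) := by
  cases o with
  | none =>
    simp only [counterLaw, PMF.pure_bind, Option.map_none]
    exact PMF.map_const _ _
  | some t =>
    simp only [counterLaw, PMF.bind_map, Option.map_some, coinCount, PMF.map_bind, PMF.map_comp]
    congr 1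
    funext c
    simp only [Function.comp_apply, Option.map_some, tick_truncate]
    rfl

/-- All entries share one coin per symbol and are dependent. Only the law of each single entry is
tracked, which is enough for a union bound. -/
theorem foldl_counterStep_law (A : DFA α Q) (G K : ℕ) (β : ℝ≥0) (hβ : β ≤ 1) (u : List α)
    (q p : Q) :
    (u.foldl (fun X a => X.bind fun m => (coin β hβ).map (counterStep A m a))
      (PMF.pure (counterInit Q G K))).map (fun m => m q p) =
      counterLaw G K β hβ (firstVisit A u.reverse q p) := by
  induction u using List.reverseRecOn generalizing q p with
  | nil =>
    simp only [List.foldl_nil, PMF.pure_map, counterInit, List.reverse_nil, firstVisit]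
    split_ifs
    · simp [counterLaw, coinCount, PMF.pure_map]
    · rfl
  | append_singleton u a ih =>
    simp only [List.foldl_append, List.foldl_cons, List.foldl_nil, List.reverse_append,
      List.reverse_singleton, List.singleton_append, firstVisit, PMF.map_bind, PMF.map_comp]
    by_cases hqp : q = p
    · rw [if_pos hqp]
      have : ∀ m : CounterState Q G K, (fun m' : CounterState Q G K => m' q p) ∘
          counterStep A m a = Function.const _ (some (0, truncate K 0)) := by
        intro m
        funext b
        simp [counterStep, hqp]
      simp only [this, PMF.map_const, PMF.bind_const]
      simp [counterLaw, coinCount, PMF.pure_map]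
    · rw [if_neg hqp, ← counterLaw_map_succ, ← ih, PMF.bind_map]
      congr 1
      funext m
      congr 1
      funext b
      simp [counterStep, hqp]

theorem counterRandomized_run (A : DFA α Q) (N G K : ℕ) (pad : α) (n : ℕ) (β : ℝ≥0) (hβ : β ≤ 1)
    (w : List α) (q p : Q) :
    ((counterRandomized A N G K pad n β hβ).run w).map (fun m => m q p) =
      counterLaw G K β hβ (firstVisit A (paddedReverse pad n w) q p) := by
  rw [paddedReverse, ← List.reverse_replicate, ← List.reverse_append, ← foldl_counterStep_law,
    List.foldl_append]
  rfl

/-- The two error bounds are asymmetric: wrong rejection may be caused by any state `p`, hence the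
factor `1 / Fintype.card Q`, while for a far window one early bad state already forces rejection.
Times between the two ranges need no estimate. -/
theorem counterRandomized_isTwoSidedTester [Fintype Q] {A : DFA α Q} {L : Language α}
    (hA : A.accepts = L.reverse) {N G K n d : ℕ}
    (hper : ∀ k, N ≤ k → Reaches A (k + G) = Reaches A k) (hG : 0 < G) (pad : α)
    (β : ℝ≥0) (hβ : β ≤ 1) (γ : ℕ → ℝ≥0) (hdγ : d ≤ γ n) (hdn : d ≤ n) (hNd : N ≤ d)
    (hlate : ∀ t : ℕ, n < t + N → (coinCount β hβ t).toOuterMeasure {c | c < K} ≤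
      1 / 3 / Fintype.card Q)
    (hearly : ∀ t : ℕ, t + d ≤ n → (coinCount β hβ t).toOuterMeasure {c | K ≤ c} ≤ 1 / 3) :
    IsTwoSidedTester pad L γ n (counterRandomized A N G K pad n β hβ) where
  accepts_of_mem w hw := by
    apply two_thirds_le_of_compl_le
    have : Nonempty Q := ⟨A.start⟩
    set R := (counterRandomized A N G K pad n β hβ).run w
    set B : Q → Set (Option (ZMod G × Fin (K + 1))) := fun p =>
      {o | ∃ x, o = some x ∧ (x.2 : ℕ) < K ∧ ¬ ReachesAccept A N p ((n : ZMod G) - x.1)}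
    have hsub : (counterRandomized A N G K pad n β hβ).finalᶜ ⊆
        ⋃ p, (fun m : CounterState Q G K => m A.start p) ⁻¹' B p := by
      intro m hm
      simp only [counterRandomized, counterFinal, Set.mem_compl_iff, Set.mem_ofPred_eq,
        not_forall] at hm
      obtain ⟨p, x, hx, hlt, hacc⟩ := hm
      exact Set.mem_iUnion.2 ⟨p, x, hx, hlt, hacc⟩
    have hB : ∀ p, R.toOuterMeasure ((fun m : CounterState Q G K => m A.start p) ⁻¹' B p) ≤
        1 / 3 / Fintype.card Q := by
      intro p
      rw [← PMF.toOuterMeasure_map_apply, counterRandomized_run]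
      cases ht : firstVisit A (paddedReverse pad n w) A.start p with
      | none =>
        rw [counterLaw, PMF.toOuterMeasure_pure_apply, if_neg (by rintro ⟨x, hx, -⟩; cases hx)]
        exact bot_le
      | some t =>
        rw [counterLaw, PMF.toOuterMeasure_map_apply]
        -- An early visit satisfies the acceptance condition whatever the counter shows; a late one
        -- can only hurt if its counter is still below `K`.
        by_cases htn : t + N ≤ n
        · have hemp : (fun c => some ((t : ZMod G), truncate K c)) ⁻¹' B p = ∅ := by
            rw [Set.eq_empty_iff_forall_notMem]
            rintro c ⟨x, hx, -, hacc⟩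
            cases hx
            exact hacc (reachesAccept_of_firstVisit (length_paddedReverse pad n w)
              ((window_mem_iff hA pad n w).1 hw) ht htn)
          rw [hemp]
          simp
        · refine le_trans (MeasureTheory.measure_mono ?_) (hlate t (by omega))
          rintro c ⟨x, hx, hlt, -⟩
          cases hx
          simp only [truncate] at hlt
          exact (by omega : c < K)
    calc R.toOuterMeasure _ ≤ R.toOuterMeasure (⋃ p, _) := MeasureTheory.measure_mono hsub
      _ ≤ ∑ p, R.toOuterMeasure ((fun m : CounterState Q G K => m A.start p) ⁻¹' B p) :=
          MeasureTheory.measure_iUnion_fintype_le _ _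
      _ ≤ ∑ _p : Q, 1 / 3 / (Fintype.card Q : ℝ≥0∞) := Finset.sum_le_sum fun p _ => hB p
      _ = 1 / 3 := by
          rw [Finset.sum_const, Finset.card_univ, nsmul_eq_mul]
          exact ENNReal.mul_div_cancel (by simp) (by simp)
  rejects_of_far w hw := by
    apply two_thirds_le_of_compl_le
    rw [compl_compl]
    have hfar : ¬ langDist (window pad n w) L ≤ d := by
      intro h
      refine hw.not_ge ?_
      calc ((langDist (window pad n w) L : ℕ∞) : ℝ≥0∞) ≤ ((d : ℕ∞) : ℝ≥0∞) := by
            exact_mod_cast h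
        _ ≤ (γ n : ℝ≥0∞) := by
            rw [ENat.toENNReal_coe]
            exact_mod_cast hdγ
    obtain ⟨p, t, ht, htd, hacc⟩ : ∃ p t, firstVisit A (paddedReverse pad n w) A.start p = some t ∧
        t + d ≤ n ∧ ¬ ReachesAccept A N p ((n : ZMod G) - (t : ZMod G)) := by
      by_contra hno
      push Not at hno
      exact hfar (langDist_window_le hA hper hG pad w hdn hNd hno)
    set B : Set (Option (ZMod G × Fin (K + 1))) :=
      {o | ∀ x, o = some x → (x.2 : ℕ) < K → ReachesAccept A N p ((n : ZMod G) - x.1)}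
    have hsub : (counterRandomized A N G K pad n β hβ).final ⊆
        (fun m : CounterState Q G K => m A.start p) ⁻¹' B := fun m hm => hm p
    refine (MeasureTheory.measure_mono hsub).trans ?_
    rw [← PMF.toOuterMeasure_map_apply, counterRandomized_run, ht, counterLaw,
      PMF.toOuterMeasure_map_apply]
    refine le_trans (MeasureTheory.measure_mono ?_) (hearly t htd)
    intro c hc
    by_contra hlt
    exact hacc (hc _ rfl (by simp only [truncate, Set.mem_ofPred_eq] at hlt ⊢; omega))

end Counters

end SlidingWindow

namespace SlidingWindow

/-! ### Space bounds and choice of parameters -/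

noncomputable section Testers

variable {α : Type*}

theorem bits_le_of_card_le {M : Type*} [Finite M] [Nonempty M] {x : ℝ} (h : (Nat.card M : ℝ) ≤ x) :
    bits M ≤ ENNReal.ofReal (Real.logb 2 x) := by
  rw [bits, if_pos ‹_›]
  exact ENNReal.ofReal_le_ofReal (Real.logb_le_logb_of_le one_lt_two
    (by exact_mod_cast Nat.card_pos) h)

theorem bits_ne_top (M : Type*) [Finite M] : bits M ≠ ⊤ := by
  rw [bits, if_pos ‹_›]
  exact ENNReal.ofReal_ne_top

theorem bits_unit : bits Unit = 0 := by
  rw [bits, if_pos (inferInstanceAs (Finite Unit))]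
  simp

theorem bits_counterState_le (Q : Type*) [Fintype Q] (G K : ℕ) (hG : 0 < G) (x : ℝ)
    (hx : (G * (K + 2) : ℝ) ≤ x) :
    bits (CounterState Q G K) ≤
      ENNReal.ofReal ((Fintype.card Q * Fintype.card Q : ℕ) * Real.logb 2 x) := by
  have : NeZero G := ⟨hG.ne'⟩
  rw [← Real.logb_pow]
  apply bits_le_of_card_le
  have hcard : Nat.card (CounterState Q G K) =
      (G * (K + 1) + 1) ^ (Fintype.card Q * Fintype.card Q) := by
    classical
    rw [Nat.card_eq_fintype_card]
    simp [ZMod.card, pow_mul]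
  rw [hcard]
  push_cast
  refine pow_le_pow_left₀ (by positivity) (le_trans ?_ hx) _
  have : (1 : ℝ) ≤ G := by exact_mod_cast hG
  linarith

theorem langDist_eq_zero_of_mem {u : List α} {L : Language α} (h : u ∈ L) : langDist u L = 0 := by
  have := langDist_le h (wordDist_append_le [] [] u rfl)
  simpa using this

/-- If the gap is at least the window size, one memory state suffices. -/
theorem exists_unit_tester (pad : α) (L : Language α) (γ : ℕ → ℝ≥0) (n : ℕ) (h : n ≤ γ n) :
    ∃ P : StreamingAlgorithm α Unit, IsDeterministicTester pad L γ n P := by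
  -- The single state is final exactly when `L` has a word of length `n`: then no window is farther
  -- than `n`, and otherwise no window is in `L`.
  refine ⟨⟨fun _ _ => (), (), {_x | ∃ v ∈ L, v.length = n}⟩, ?_, ?_⟩
  · intro w hw
    exact ⟨_, hw, length_window pad n w⟩
  · rintro w hw ⟨v, hv, hvn⟩
    refine hw.not_ge ?_
    have hle : langDist (window pad n w) L ≤ n := by
      have := langDist_le_length (u := window pad n w) hv (by rw [length_window, hvn])
      rwa [length_window] at this
    calc ((langDist (window pad n w) L : ℕ∞) : ℝ≥0∞) ≤ ((n : ℕ∞) : ℝ≥0∞) := by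
          exact_mod_cast hle
      _ ≤ (γ n : ℝ≥0∞) := by
          rw [ENat.toENNReal_coe]
          exact_mod_cast h

/-- The automaton that stores the active window. -/
def windowDFA (pad : α) (L : Language α) (n : ℕ) : DFA α (List.Vector α n) where
  step m a := ⟨window pad n (m.1 ++ [a]), length_window pad n _⟩
  start := ⟨window pad n [], length_window pad n _⟩
  accept := {m | m.1 ∈ L}

theorem windowDFA_eval (pad : α) (L : Language α) (n : ℕ) (w : List α) :
    ((windowDFA pad L n).eval w).1 = window pad n w := by
  induction w using List.reverseRecOn with
  | nil => rfl
  | append_singleton w a ih =>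
    rw [DFA.eval_append_singleton]
    change window pad n (((windowDFA pad L n).eval w).1 ++ [a]) = _
    rw [ih, window_window_append]

theorem exists_window_tester [Fintype α] (pad : α) (L : Language α) (γ : ℕ → ℝ≥0) (n : ℕ) :
    ∃ P : StreamingAlgorithm α (Fin (Fintype.card α ^ n)), IsDeterministicTester pad L γ n P := by
  have e : List.Vector α n ≃ Fin (Fintype.card α ^ n) :=
    Fintype.equivFinOfCardEq (card_vector n)
  have hmem : ∀ w, w ∈ (DFA.reindex e (windowDFA pad L n)).accepts ↔ window pad n w ∈ L := by
    intro w
    rw [DFA.accepts_reindex, ← windowDFA_eval pad L n w]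
    rfl
  refine ⟨DFA.reindex e (windowDFA pad L n), fun w hw => (hmem w).2 hw, fun w hw hacc => ?_⟩
  rw [langDist_eq_zero_of_mem ((hmem w).1 hacc)] at hw
  simp at hw

/-- A deterministic streaming algorithm, viewed as a randomized one. -/
def StreamingAlgorithm.toRandomized {M : Type*} (P : StreamingAlgorithm α M) :
    RandomizedStreamingAlgorithm α M where
  init := PMF.pure P.start
  step m a := PMF.pure (P.step m a)
  final := P.accept

theorem StreamingAlgorithm.toRandomized_run {M : Type*} (P : StreamingAlgorithm α M)
    (w : List α) : P.toRandomized.run w = PMF.pure (DFA.eval P w) := by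
  induction w using List.reverseRecOn with
  | nil => rfl
  | append_singleton w a ih =>
    rw [RandomizedStreamingAlgorithm.run] at ih ⊢
    rw [List.foldl_append, ih, DFA.eval_append_singleton]
    simp [toRandomized]

theorem IsDeterministicTester.toRandomized {M : Type*} {pad : α} {L : Language α} {γ : ℕ → ℝ≥0}
    {n : ℕ} {P : StreamingAlgorithm α M} (h : IsDeterministicTester pad L γ n P) :
    IsTwoSidedTester pad L γ n P.toRandomized := by
  have h23 : (2 / 3 : ℝ≥0∞) ≤ 1 := ENNReal.div_le_of_le_mul (by norm_num)
  constructor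
  · intro w hw
    have := h.accepts_of_mem w hw
    rw [RandomizedStreamingAlgorithm.acceptProb, StreamingAlgorithm.toRandomized_run,
      PMF.toOuterMeasure_pure_apply, if_pos]
    · exact h23
    · exact this
  · intro w hw
    have := h.rejects_of_far w hw
    rw [RandomizedStreamingAlgorithm.rejectProb, StreamingAlgorithm.toRandomized_run,
      PMF.toOuterMeasure_pure_apply, if_pos]
    · exact h23
    · exact this

section Regular

variable {Q : Type} [Fintype Q] {A : DFA α Q} {L : Language α} {N G : ℕ}

theorem exists_deterministic_tester (hA : A.accepts = L.reverse)
    (hper : ∀ k, N ≤ k → Reaches A (k + G) = Reaches A k) (hG : 0 < G) (pad : α) (n : ℕ) :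
    ∃ (M : Type) (P : StreamingAlgorithm α M),
      IsDeterministicTester pad L (fun _ => (N : ℝ≥0)) n P ∧ P.space ≠ ⊤ ∧
      (2 ≤ n → P.space ≤ ENNReal.ofReal (((Fintype.card Q * Fintype.card Q : ℕ) *
        (Real.logb 2 G + 3)) * Real.logb 2 n)) := by
  by_cases hn : N ≤ n
  · have : NeZero G := ⟨hG.ne'⟩
    refine ⟨CounterState Q G (n - N + 1), counterDFA A N G (n - N + 1) pad n,
      counterDFA_isDeterministicTester hA hper hG pad hn _ le_rfl, bits_ne_top _, fun h2 => ?_⟩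
    have h2' : (2 : ℝ) ≤ n := by exact_mod_cast h2
    have hG1 : (1 : ℝ) ≤ G := by exact_mod_cast hG
    -- Here `K + 2 ≤ n + 3 ≤ n ^ 3`, as `n ≥ 2`.
    refine (bits_counterState_le Q G _ hG (G * (n : ℝ) ^ 3) ?_).trans ?_
    · gcongr
      have : ((n - N + 1 : ℕ) : ℝ) ≤ n + 1 := by exact_mod_cast (by omega : n - N + 1 ≤ n + 1)
      nlinarith [mul_nonneg (sub_nonneg.2 h2') (sub_nonneg.2 h2')]
    · rw [Real.logb_mul (by positivity) (by positivity), Real.logb_pow, mul_assoc]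
      apply ENNReal.ofReal_le_ofReal
      gcongr
      have h1 : 1 ≤ Real.logb 2 n := by
        rw [Real.le_logb_iff_rpow_le one_lt_two (by positivity)]
        simpa using h2'
      have h0 : 0 ≤ Real.logb 2 G := Real.logb_nonneg one_lt_two hG1
      push_cast
      nlinarith [mul_nonneg h0 (sub_nonneg.2 h1)]
  · obtain ⟨P, hP⟩ := exists_unit_tester pad L (fun _ => (N : ℝ≥0)) n
      (by exact_mod_cast (not_le.1 hn).le)
    exact ⟨Unit, P, hP, bits_ne_top _, fun _ => bits_unit.le.trans bot_le⟩

/-- The binomial counter distinguishes times below `(1 - 3ε/4) n` from times above `(1 - ε/4) n`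
with constant error. -/
theorem coinCount_threshold {a n : ℕ} (ha : 1 ≤ a) {ε κ : ℝ} (hε : 0 < ε) (hε1 : ε < 1)
    (hκ : κ * ε ^ 2 = 60 * a) (hn : 0 < n) (β : ℝ≥0) (hβ : β ≤ 1) (hβn : β * n = κ) :
    (∀ t : ℕ, n * (1 - ε / 4) ≤ t →
      (coinCount β hβ t).toOuterMeasure {c | c < ⌈κ * (1 - ε / 2)⌉₊} ≤ 1 / 3 / a) ∧
    (∀ t : ℕ, t ≤ n * (1 - 3 * ε / 4) →
      (coinCount β hβ t).toOuterMeasure {c | ⌈κ * (1 - ε / 2)⌉₊ ≤ c} ≤ 1 / 3) := by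
  have ha' : (1 : ℝ) ≤ a := by exact_mod_cast ha
  have hn' : (0 : ℝ) < n := by exact_mod_cast hn
  have hκ0 : 0 < κ := by
    by_contra h
    nlinarith [mul_nonneg (neg_nonneg.2 (not_lt.1 h)) (sq_nonneg ε)]
  have hκε : 0 < κ * ε / 4 := by positivity
  constructor
  · intro t ht
    have hx : κ * (1 - ε / 4) ≤ β * t := by
      rw [← hβn, mul_assoc]
      gcongr
    have hδ : (1 / 3 / a : ℝ≥0∞) = ENNReal.ofReal (1 / 3 / a) := by
      rw [ENNReal.ofReal_div_of_pos (by positivity), ENNReal.ofReal_div_of_pos (by norm_num)]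
      simp
    rw [hδ]
    have hy : κ * ε / 4 ≤ β * t - κ * (1 - ε / 2) := by linarith
    -- The variance bound `β * t` is unbounded in `t`, so the deviation must grow with `t` too.
    refine coinCount_le_of_deviation β hβ t _ (β * t - κ * (1 - ε / 2)) _ ?_ (by linarith) ?_
    · intro c hc
      have hc' : (c : ℝ) < κ * (1 - ε / 2) := Nat.lt_ceil.1 hc
      rw [abs_sub_comm]
      exact le_trans (by linarith) (le_abs_self _)
    · set y := β * t - κ * (1 - ε / 2) with hydef
      have hβt : (β : ℝ) * t ≤ y + κ := by nlinarith
      -- From `y ≥ κ * ε / 4` and `κ * ε ^ 2 = 60 * a`; the constant 15 is the product of the 3 in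
      -- the error bound and the 5 of `h3`.
      have h1 : 15 * a ≤ ε * y := by nlinarith
      have h2 : y * (15 * a) ≤ y * (ε * y) := mul_le_mul_of_nonneg_left h1 (by linarith)
      have h3 : ε * (y + κ) ≤ 5 * y := by nlinarith
      have h4 : ε * (3 * a * (y + κ)) ≤ ε * y ^ 2 := by nlinarith
      have h5 : 3 * a * (y + κ) ≤ y ^ 2 := le_of_mul_le_mul_left h4 hε
      rw [div_div, one_div_mul_eq_div, le_div_iff₀ (by positivity)]
      nlinarith
  · intro t ht
    have hx : β * t ≤ κ * (1 - 3 * ε / 4) := by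
      rw [← hβn, mul_assoc]
      gcongr
    have hδ : (1 / 3 : ℝ≥0∞) = ENNReal.ofReal (1 / 3) := by
      rw [ENNReal.ofReal_div_of_pos (by norm_num)]
      simp
    rw [hδ]
    refine coinCount_le_of_deviation β hβ t _ (κ * ε / 4) _ ?_ hκε ?_
    · intro c hc
      have hc' : κ * (1 - ε / 2) ≤ (c : ℝ) := Nat.ceil_le.1 hc
      exact le_trans (by linarith) (le_abs_self _)
    · have : κ * κ * ε ^ 2 = κ * (60 * a) := by rw [mul_assoc, hκ]
      nlinarith

/-- The crude bound `Real.logb 2 ε⁻¹ ≤ 2 * ε⁻¹` suffices, because the target is only `O(1 / ε)`. -/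
theorem logb_two_le_of_le_div_sq {x c ε : ℝ} (hx : 0 < x) (hε : 0 < ε) (hε1 : ε < 1) (hc : 1 ≤ c)
    (h : x ≤ c / ε ^ 2) : Real.logb 2 x ≤ (Real.logb 2 c + 4) / ε := by
  have hinv : Real.logb 2 ε⁻¹ ≤ 2 * ε⁻¹ := by
    have h1 : Real.log ε⁻¹ ≤ ε⁻¹ := (Real.log_le_sub_one_of_pos (by positivity)).trans (by linarith)
    rw [Real.logb, div_le_iff₀ (Real.log_pos one_lt_two)]
    have : 0 < ε⁻¹ := by positivity
    nlinarith [Real.log_two_gt_d9]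
  have hc0 : 0 ≤ Real.logb 2 c := Real.logb_nonneg one_lt_two hc
  have h1 : 1 ≤ ε⁻¹ := (one_le_inv₀ hε).2 hε1.le
  calc Real.logb 2 x ≤ Real.logb 2 (c / ε ^ 2) := Real.logb_le_logb_of_le one_lt_two hx h
    _ = Real.logb 2 c + 2 * Real.logb 2 ε⁻¹ := by
        rw [div_eq_mul_inv, ← inv_pow, Real.logb_mul (by positivity) (by positivity),
          Real.logb_pow]
        norm_num
    _ ≤ (Real.logb 2 c + 4) / ε := by
        rw [div_eq_mul_inv]
        nlinarith

theorem exists_randomized_tester [Fintype α] (hA : A.accepts = L.reverse)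
    (hper : ∀ k, N ≤ k → Reaches A (k + G) = Reaches A k) (hG : 0 < G) (pad : α)
    {ε : ℝ≥0} (hε : 0 < ε) (hε1 : ε < 1) (n : ℕ) :
    ∃ (M : Type) (P : RandomizedStreamingAlgorithm α M),
      IsTwoSidedTester pad L (fun m => ε * m) n P ∧
      P.space ≤ ENNReal.ofReal ((4 * (N + 1) * Real.logb 2 (Fintype.card α) +
        (Fintype.card Q * Fintype.card Q : ℕ) *
          (Real.logb 2 (63 * Fintype.card Q * G) + 4)) / ε) := by
  have : Nonempty Q := ⟨A.start⟩
  have : Nonempty α := ⟨pad⟩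
  set a := Fintype.card Q with ha_def
  set s := Fintype.card α with hs_def
  have ha : 1 ≤ a := Fintype.card_pos
  have ha' : (1 : ℝ) ≤ a := by exact_mod_cast ha
  have hs : 1 ≤ s := Fintype.card_pos
  have hG1 : (1 : ℝ) ≤ G := by exact_mod_cast hG
  have hε' : (0 : ℝ) < ε := by exact_mod_cast hε
  have hε1' : (ε : ℝ) < 1 := by exact_mod_cast hε1
  have hs0 : 0 ≤ Real.logb 2 s := Real.logb_nonneg one_lt_two (by exact_mod_cast hs)
  have hc1 : (1 : ℝ) ≤ 63 * a * G := by nlinarith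
  have hc0 : 0 ≤ Real.logb 2 (63 * a * G) := Real.logb_nonneg one_lt_two hc1
  -- Short windows are stored. Otherwise `ε * n / 4` exceeds both `N` and the rounding loss in `⌊ε *
  -- n⌋₊`, which places late and early visits in the ranges of `coinCount_threshold`.
  rcases lt_or_ge ((ε : ℝ) * n) (4 * (N + 1)) with hsmall | hlarge
  · obtain ⟨P, hP⟩ := exists_window_tester pad L (fun m => ε * m) n
    refine ⟨_, _, hP.toRandomized, ?_⟩
    have : Nonempty (Fin (s ^ n)) := ⟨⟨0, by positivity⟩⟩
    refine (bits_le_of_card_le (x := (s : ℝ) ^ n) (by simp [hs_def])).trans ?_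
    apply ENNReal.ofReal_le_ofReal
    rw [Real.logb_pow, le_div_iff₀ hε']
    have h1 : (0 : ℝ) ≤ (a * a : ℕ) * (Real.logb 2 (63 * a * G) + 4) := by positivity
    nlinarith
  · set κ : ℝ := 60 * a / (ε : ℝ) ^ 2 with hκ_def
    have hκ : κ * (ε : ℝ) ^ 2 = 60 * a := by rw [hκ_def]; field_simp
    have hκ0 : 0 < κ := by positivity
    have hspace : ∀ K : ℕ, (K : ℝ) ≤ κ + 1 → bits (CounterState Q G K) ≤
        ENNReal.ofReal ((4 * (N + 1) * Real.logb 2 s +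
          (a * a : ℕ) * (Real.logb 2 (63 * a * G) + 4)) / ε) := by
      intro K hK
      refine (bits_counterState_le Q G K hG (G * (κ + 3))
        (mul_le_mul_of_nonneg_left (by linarith) (by positivity))).trans ?_
      apply ENNReal.ofReal_le_ofReal
      have h1 : G * (κ + 3) ≤ 63 * a * G / (ε : ℝ) ^ 2 := by
        rw [le_div_iff₀ (by positivity)]
        have : (ε : ℝ) ^ 2 ≤ 1 := pow_le_one₀ hε'.le hε1'.le
        have : (κ + 3) * (ε : ℝ) ^ 2 ≤ 63 * a := by nlinarith
        nlinarith
      have h2 := logb_two_le_of_le_div_sq (by positivity) hε' hε1' hc1 h1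
      rw [add_div, mul_div_assoc _ _ (ε : ℝ)]
      have h3 : 0 ≤ 4 * (N + 1) * Real.logb 2 s / ε := by positivity
      have h4 := mul_le_mul_of_nonneg_left h2 (Nat.cast_nonneg (α := ℝ) (a * a))
      rw [← mul_div_assoc] at h4 ⊢
      linarith
    have hN0 : (0 : ℝ) ≤ N := Nat.cast_nonneg N
    have hNεn : (N : ℝ) ≤ ε * n := by linarith
    have hn0 : (0 : ℝ) < n := by
      by_contra h
      nlinarith
    have hεn : (ε : ℝ) * n ≤ n := by nlinarith
    have hNn : N ≤ n := by exact_mod_cast hNεn.trans hεn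
    -- The increment probability `κ / n` must be at most 1; for `n ≤ κ` the exact counter is already
    -- small enough.
    rcases le_or_gt (n : ℝ) κ with hnκ | hnκ
    · refine ⟨_, _, (counterDFA_isDeterministicTester hA hper hG pad hNn (fun m => ε * m)
        (by exact_mod_cast hNεn)).toRandomized, hspace _ ?_⟩
      have : ((n - N + 1 : ℕ) : ℝ) ≤ n + 1 := by exact_mod_cast (by omega : n - N + 1 ≤ n + 1)
      linarith
    · set β : ℝ≥0 := ⟨κ / n, by positivity⟩ with hβ_def
      have hβn : (β : ℝ) * n = κ := div_mul_cancel₀ _ hn0.ne'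
      have hβ : β ≤ 1 := by
        rw [← NNReal.coe_le_coe]
        exact (div_le_one hn0).2 hnκ.le
      obtain ⟨hlate, hearly⟩ := coinCount_threshold ha hε' hε1' hκ (by exact_mod_cast hn0) β hβ hβn
      have hfloor : (⌊(ε : ℝ) * n⌋₊ : ℝ) ≤ ε * n := Nat.floor_le (by positivity)
      have hfloor' : (ε : ℝ) * n < ⌊(ε : ℝ) * n⌋₊ + 1 := Nat.lt_floor_add_one _
      refine ⟨_, counterRandomized A N G ⌈κ * (1 - ε / 2)⌉₊ pad n β hβ,
        counterRandomized_isTwoSidedTester (d := ⌊(ε : ℝ) * n⌋₊) hA hper hG pad β hβ _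
          (by exact_mod_cast hfloor) (by exact_mod_cast hfloor.trans hεn) (Nat.le_floor hNεn)
          (fun t ht => hlate t ?_) (fun t ht => hearly t ?_), hspace _ ?_⟩
      · have : (n : ℝ) < t + N := by exact_mod_cast ht
        linarith
      · have : (t : ℝ) + ⌊(ε : ℝ) * n⌋₊ ≤ n := by exact_mod_cast ht
        linarith
      · have := Nat.ceil_lt_add_one (a := κ * (1 - ε / 2)) (by nlinarith)
        nlinarith

end Regular

end Testers

end SlidingWindow

open SlidingWindow in
theorem mainTheorem3 {α : Type*} [Finite α] (pad : α) (L : Language α) (hL : L.IsRegular) :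
    (∃ (c : ℝ≥0) (M : ℕ → Type) (P : ∀ n, SlidingWindow.StreamingAlgorithm α (M n)),
      (∀ n, SlidingWindow.IsDeterministicTester pad L (fun _ => c) n (P n)) ∧
      (∀ n, (P n).space ≠ ⊤) ∧
      ∃ C : ℝ≥0, ∀ n : ℕ, 2 ≤ n → (P n).space ≤ ENNReal.ofReal (C * Real.logb 2 n)) ∧
    (∃ C : ℝ≥0, ∀ ε : ℝ≥0, 0 < ε →
      ∃ (M : ℕ → Type) (P : ∀ n, SlidingWindow.RandomizedStreamingAlgorithm α (M n)),
        (∀ n, SlidingWindow.IsTwoSidedTester pad L (fun m => ε * m) n (P n)) ∧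
        ∀ n, (P n).space ≤ ((C / ε : ℝ≥0) : ℝ≥0∞)) := by
  have := Fintype.ofFinite α
  obtain ⟨Q, _, A, hA⟩ := hL.reverse
  obtain ⟨N, G, hG, hper⟩ := exists_reaches_periodic A
  constructor
  · choose M P h₁ h₂ h₃ using exists_deterministic_tester hA hper hG pad
    refine ⟨N, M, P, h₁, h₂, Real.toNNReal ((Fintype.card Q * Fintype.card Q : ℕ) *
      (Real.logb 2 G + 3)), fun n hn => (h₃ n hn).trans (ENNReal.ofReal_le_ofReal ?_)⟩
    have : 0 ≤ Real.logb 2 (n : ℝ) :=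
      Real.logb_nonneg one_lt_two (by exact_mod_cast (by omega : 1 ≤ n))
    gcongr
    exact Real.le_coe_toNNReal _
  · refine ⟨Real.toNNReal (4 * (N + 1) * Real.logb 2 (Fintype.card α) +
      (Fintype.card Q * Fintype.card Q : ℕ) * (Real.logb 2 (63 * Fintype.card Q * G) + 4)),
      fun ε hε => ?_⟩
    rcases lt_or_ge ε 1 with hε1 | hε1
    · choose M P h₁ h₂ using exists_randomized_tester hA hper hG pad hε hε1
      refine ⟨M, P, h₁, fun n => (h₂ n).trans ?_⟩
      rw [ENNReal.ofReal, ENNReal.coe_le_coe, Real.toNNReal_div' ε.coe_nonneg, Real.toNNReal_coe]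
    · have hunit := fun n : ℕ => exists_unit_tester pad L (fun m => ε * m) n
        (le_mul_of_one_le_left (by positivity) hε1)
      choose P hP using hunit
      exact ⟨fun _ => Unit, fun n => (P n).toRandomized, fun n => (hP n).toRandomized,
        fun n => bits_unit.le.trans bot_le⟩
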